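/- Let $\nu\in\mathbb C^*$ be generic, that is, not a root of unity. Let $R=\mathbb C_\nu[x^{\pm1},y^{\pm1}]$ be the quantum torus, the associative unital $\mathbb C$-algebra generated by $x^{\pm1},y^{\pm1}$ with defining relation $yx=\nu xy$. Let $B=S^{-1}R=\mathbb C(x)[y^{\pm1}]$ be its localization at $S=\mathbb C[x^{\pm1}]\setminus\{0\}$, in which $yf(x)=f(\nu x)y$ for $f\in\mathbb C(x)$; regard $R$ as a subring of $B$, and $B$ as a left $R$-module. For $\lambda\in\mathbb C^*$ let $M_\lambda$ be the left $R$-module with underlying vector space $\mathbb C[y^{\pm1}]\cdot\mathbf 1_\lambda$, on which $y$ acts by multiplication and $x$ acts by $x\cdot y^i\mathbf 1_\lambda=\lambda\nu^{-i}y^i\mathbf 1_\lambda$ for $i\in\mathbb Z$ (so $x\cdot\mathbf 1_\lambda=\lambda\mathbf 1_\lambda$). Let $M$ be a simple left $R$-module. Then one of the following holds: (i) there exists $\lambda\in\mathbb C^*$ such that $M\cong M_\lambda$ as $R$-modules; (ii) there exists $\alpha\in R$ such that $\alpha$ is irreducible in $B$ (a non-unit of $B$ such that $\alpha=bc$ with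 $b,c\in B$ implies that $b$ or $c$ is a unit of $B$) and $M\cong(R+B\alpha)/B\alpha$ as $R$-modules. -/

import Mathlib

open scoped LaurentPolynomial Polynomial

noncomputable section

/-! ### Skew Laurent polynomial rings -/

/-- The skew Laurent polynomial ring `A[y, y⁻¹; σ]` over a commutative ring `A` with an automorphism
`σ`: its elements are the finite sums `∑ aᵢ yⁱ` (`i ∈ ℤ`, `aᵢ ∈ A`), and `y a = σ(a) y`. It is the
skew group ring of the infinite cyclic group `{yⁱ}`, in which `yⁱ` acts on `A` as `σⁱ`; the element
`a yⁱ` is `SkewMonoidAlgebra.single (Multiplicative.ofAdd i) a`. -/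
def SkewLaurent (A : Type*) [CommRing A] (_σ : A ≃+* A) : Type _ :=
  SkewMonoidAlgebra A (Multiplicative ℤ)

namespace SkewLaurent

variable {A : Type*} [CommRing A] (σ : A ≃+* A)

/-- The action of the infinite cyclic group on `A` in which the generator acts as `σ`. -/
@[reducible]
def cyclicAction : MulSemiringAction (Multiplicative ℤ) A :=
  MulSemiringAction.compHom A (zpowersHom (RingAut A) σ)

instance : Ring (SkewLaurent A σ) :=
  letI := cyclicAction σ
  inferInstanceAs (Ring (SkewMonoidAlgebra A (Multiplicative ℤ)))

/-- The element `a yⁱ`. -/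
def monomial (i : ℤ) (a : A) : SkewLaurent A σ :=
  SkewMonoidAlgebra.single (Multiplicative.ofAdd i) a

theorem semiconj_zpow {D : Type*} [Ring D] (f : A →+* D) (u : Dˣ)
    (h : ∀ a, (u : D) * f a = f (σ a) * u) (n : ℤ) (a : A) :
    f ((σ ^ n : RingAut A) a) * ((u ^ n : Dˣ) : D) = ((u ^ n : Dˣ) : D) * f a := by
  induction n generalizing a with
  | zero => simp
  | succ n ih =>
    rw [zpow_add_one, zpow_add_one, Units.val_mul, mul_assoc, h, ← mul_assoc _ (f (σ a)), ← ih (σ a), mul_assoc]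
    rfl
  | pred n ih =>
    have h' : ∀ a, ((u⁻¹ : Dˣ) : D) * f a = f ((σ⁻¹ : RingAut A) a) * ((u⁻¹ : Dˣ) : D) := by
      intro a
      rw [Units.inv_mul_eq_iff_eq_mul, ← mul_assoc, h, mul_assoc, Units.mul_inv, mul_one]
      congr 1
      exact (σ.apply_symm_apply a).symm
    rw [zpow_sub_one, zpow_sub_one, Units.val_mul, mul_assoc, h', ← mul_assoc _ (f _), ← ih ((σ⁻¹ : RingAut A) a),
      mul_assoc]
    rfl

/-- The ring homomorphism `A[y, y⁻¹; σ] → D` that extends `f : A → D` and sends `y` to the unit `u`,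
that is, `∑ aᵢ yⁱ ↦ ∑ f(aᵢ) uⁱ`; it exists when `u f(a) = f(σ(a)) u` for all `a`. -/
def lift {D : Type*} [Ring D] (f : A →+* D) (u : Dˣ) (h : ∀ a, (u : D) * f a = f (σ a) * u) :
    SkewLaurent A σ →+* D :=
  letI := cyclicAction σ
  SkewMonoidAlgebra.liftNCRingHom (k := A) (G := Multiplicative ℤ) f
    ((Units.coeHom D).comp (zpowersHom Dˣ u)) (fun {a n} => semiconj_zpow σ f u h n.toAdd a)

theorem monomial_mul_monomial (i j : ℤ) (a b : A) :
    monomial σ i a * monomial σ j b = monomial σ (i + j) (a * (σ ^ i : RingAut A) b) := by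
  let := cyclicAction σ
  exact SkewMonoidAlgebra.single_mul_single

theorem monomial_zero_one : monomial σ 0 1 = 1 := rfl

/-- The element `y`, as a unit. -/
def y : (SkewLaurent A σ)ˣ where
  val := monomial σ 1 1
  inv := monomial σ (-1) 1
  val_inv := by rw [monomial_mul_monomial, map_one, mul_one]; exact monomial_zero_one σ
  inv_val := by rw [monomial_mul_monomial, map_one, mul_one]; exact monomial_zero_one σ

/-- The inclusion of the coefficient ring. -/
def coeffHom : A →+* SkewLaurent A σ where
  toFun a := monomial σ 0 a
  map_one' := monomial_zero_one σ
  map_zero' := SkewMonoidAlgebra.single_zero _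
  map_add' a b := SkewMonoidAlgebra.single_add _ a b
  map_mul' a b := by rw [monomial_mul_monomial]; rfl

theorem y_mul_coeffHom (a : A) :
    (y σ : SkewLaurent A σ) * coeffHom σ a = coeffHom σ (σ a) * (y σ : SkewLaurent A σ) := by
  change monomial σ 1 1 * monomial σ 0 a = monomial σ 0 (σ a) * monomial σ 1 1
  rw [monomial_mul_monomial, monomial_mul_monomial]
  simp

end SkewLaurent

/-! ### Laurent polynomials and rational functions -/

/-- Evaluation of Laurent polynomials over `ℂ` at a unit `u` of a `ℂ`-algebra: `p ↦ p(u)`. -/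
def laurentEval {D : Type*} [Ring D] [Algebra ℂ D] (u : Dˣ) : ℂ[T;T⁻¹] →ₐ[ℂ] D :=
  AddMonoidAlgebra.lift ℂ D ℤ ((Units.coeHom D).comp (zpowersHom Dˣ u))

theorem laurentEval_T {D : Type*} [Ring D] [Algebra ℂ D] (u : Dˣ) (n : ℤ) :
    laurentEval u (LaurentPolynomial.T n) = ((u ^ n : Dˣ) : D) := by
  rw [laurentEval, LaurentPolynomial.T, AddMonoidAlgebra.lift_single, one_smul]
  rfl

theorem laurent_algHom_ext {D : Type*} [Ring D] [Algebra ℂ D] {f g : ℂ[T;T⁻¹] →ₐ[ℂ] D}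
    (h : ∀ n : ℤ, f (LaurentPolynomial.T n) = g (LaurentPolynomial.T n)) : f = g := by
  refine (AddMonoidAlgebra.lift ℂ D ℤ).symm.injective (MonoidHom.ext fun n => ?_)
  exact h n.toAdd

/-- The variable of `ℂ[T;T⁻¹]`, as a unit. -/
def laurentVar : (ℂ[T;T⁻¹])ˣ where
  val := LaurentPolynomial.T 1
  inv := LaurentPolynomial.T (-1)
  val_inv := by rw [← LaurentPolynomial.T_add]; simp
  inv_val := by rw [← LaurentPolynomial.T_add]; simp

theorem laurentVar_zpow (n : ℤ) :
    ((laurentVar ^ n : (ℂ[T;T⁻¹])ˣ) : ℂ[T;T⁻¹]) = LaurentPolynomial.T n := by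
  induction n with
  | zero => simp
  | succ n ih => rw [zpow_add_one, Units.val_mul, ih, LaurentPolynomial.T_add]; rfl
  | pred n ih =>
    rw [zpow_sub_one, Units.val_mul, ih, sub_eq_add_neg, LaurentPolynomial.T_add]; rfl

/-- The substitution `p(T) ↦ p(cT)` on Laurent polynomials, as an algebra homomorphism. -/
def laurentScaleHom (c : ℂˣ) : ℂ[T;T⁻¹] →ₐ[ℂ] ℂ[T;T⁻¹] :=
  laurentEval (Units.map (algebraMap ℂ ℂ[T;T⁻¹] : ℂ →* ℂ[T;T⁻¹]) c * laurentVar)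

theorem laurentScaleHom_T (c : ℂˣ) (n : ℤ) :
    laurentScaleHom c (LaurentPolynomial.T n) = ((c ^ n : ℂˣ) : ℂ) • LaurentPolynomial.T n := by
  rw [laurentScaleHom, laurentEval_T, mul_zpow, Units.val_mul, laurentVar_zpow, ← map_zpow,
    Algebra.smul_def]
  rfl

/-- The automorphism `p(T) ↦ p(cT)` of `ℂ[T;T⁻¹]`. -/
def laurentScale (c : ℂˣ) : ℂ[T;T⁻¹] ≃ₐ[ℂ] ℂ[T;T⁻¹] :=
  AlgEquiv.ofAlgHom (laurentScaleHom c) (laurentScaleHom c⁻¹)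
    (laurent_algHom_ext fun n => by
      rw [AlgHom.comp_apply, laurentScaleHom_T, map_smul, laurentScaleHom_T, smul_smul,
        ← Units.val_mul, ← mul_zpow]
      simp)
    (laurent_algHom_ext fun n => by
      rw [AlgHom.comp_apply, laurentScaleHom_T, map_smul, laurentScaleHom_T, smul_smul,
        ← Units.val_mul, ← mul_zpow]
      simp)

/-- The automorphism `f(x) ↦ f(cx)` of the field `ℂ(x)`. -/
def ratFuncScale (c : ℂˣ) : RatFunc ℂ ≃+* RatFunc ℂ :=
  IsFractionRing.ringEquivOfRingEquiv (A := ℂ[X]) (B := ℂ[X])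
    (Polynomial.algEquivOfCompEqX (Polynomial.C (c : ℂ) * Polynomial.X)
      (Polynomial.C ((c⁻¹ : ℂˣ) : ℂ) * Polynomial.X)
      (by simp [← mul_assoc, ← Polynomial.C_mul])
      (by simp [← mul_assoc, ← Polynomial.C_mul])).toRingEquiv

theorem ratFuncScale_X (c : ℂˣ) : ratFuncScale c RatFunc.X = RatFunc.C (c : ℂ) * RatFunc.X := by
  rw [ratFuncScale, ← RatFunc.algebraMap_X, IsFractionRing.ringEquivOfRingEquiv_algebraMap]
  simp [Polynomial.algEquivOfCompEqX]

theorem ratFuncScale_C (c : ℂˣ) (a : ℂ) : ratFuncScale c (RatFunc.C a) = RatFunc.C a := by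
  rw [ratFuncScale, ← RatFunc.algebraMap_C, IsFractionRing.ringEquivOfRingEquiv_algebraMap]
  simp [Polynomial.algEquivOfCompEqX]

/-- The inclusion `ℂ[x, x⁻¹] → ℂ(x)`. -/
def laurentToRatFunc : ℂ[T;T⁻¹] →ₐ[ℂ] RatFunc ℂ :=
  laurentEval (Units.mk0 RatFunc.X RatFunc.X_ne_zero)

theorem laurentToRatFunc_scale (c : ℂˣ) (p : ℂ[T;T⁻¹]) :
    laurentToRatFunc (laurentScale c p) = ratFuncScale c (laurentToRatFunc p) := by
  have hX : ∀ n : ℤ, laurentToRatFunc (LaurentPolynomial.T n) = RatFunc.X ^ n := fun n => by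
    rw [laurentToRatFunc, laurentEval_T, Units.val_zpow_eq_zpow_val]
    rfl
  induction p using LaurentPolynomial.induction_on' with
  | add p q hp hq => simp only [map_add, hp, hq]
  | C_mul_T n a =>
    have e : (LaurentPolynomial.C a * LaurentPolynomial.T n : ℂ[T;T⁻¹])
        = a • LaurentPolynomial.T n := by rw [Algebra.smul_def]; rfl
    have e' : ∀ (z : ℂ) (f : RatFunc ℂ), z • f = RatFunc.C z * f := fun z f =>
      RatFunc.smul_eq_C_mul z f
    have e'' : laurentScale c (LaurentPolynomial.T n)
        = ((c ^ n : ℂˣ) : ℂ) • LaurentPolynomial.T n := laurentScaleHom_T c n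
    rw [e, map_smul, map_smul, map_smul, e'', map_smul, hX, e', e', e', map_mul, map_zpow₀,
      ratFuncScale_X, ratFuncScale_C, mul_zpow, Units.val_zpow_eq_zpow_val, map_zpow₀]

/-! ### The quantum torus and its localization -/

/-- The quantum torus `R = ℂ_ν[x^{±1}, y^{±1}]`, with `y x = ν x y`: the skew Laurent polynomial ring
in `y` over `ℂ[x, x⁻¹]`, in which `y p(x) = p(νx) y`. -/
abbrev QuantumTorus (ν : ℂˣ) : Type :=
  SkewLaurent ℂ[T;T⁻¹] (laurentScale ν).toRingEquiv

/-- The localization `B = ℂ(x)[y^{±1}]` of the quantum torus at the nonzero elements of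
`ℂ[x, x⁻¹]`: the skew Laurent polynomial ring in `y` over `ℂ(x)`, in which `y f(x) = f(νx) y`. -/
abbrev LocalizedTorus (ν : ℂˣ) : Type :=
  SkewLaurent (RatFunc ℂ) (ratFuncScale ν)

/-- The inclusion `R → B`, `∑ pᵢ(x) yⁱ ↦ ∑ pᵢ(x) yⁱ`. -/
def torusInclusion (ν : ℂˣ) : QuantumTorus ν →+* LocalizedTorus ν :=
  SkewLaurent.lift _ ((SkewLaurent.coeffHom (ratFuncScale ν)).comp laurentToRatFunc.toRingHom)
    (SkewLaurent.y (ratFuncScale ν)) (fun p => by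
      refine (SkewLaurent.y_mul_coeffHom (ratFuncScale ν) (laurentToRatFunc p)).trans ?_
      rw [← laurentToRatFunc_scale]
      rfl)

/-- `B` is an `R`-module through left multiplication. -/
instance (ν : ℂˣ) : Module (QuantumTorus ν) (LocalizedTorus ν) :=
  Module.compHom (LocalizedTorus ν) (torusInclusion ν)

/-- `R`, as an `R`-submodule of `B`. -/
def torusSubmodule (ν : ℂˣ) : Submodule (QuantumTorus ν) (LocalizedTorus ν) where
  carrier := Set.range (torusInclusion ν)
  zero_mem' := ⟨0, map_zero _⟩
  add_mem' := by
    rintro _ _ ⟨a, rfl⟩ ⟨b, rfl⟩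
    exact ⟨a + b, map_add _ _ _⟩
  smul_mem' := by
    rintro r _ ⟨a, rfl⟩
    exact ⟨r * a, map_mul _ _ _⟩

/-- The left ideal `Bα = {bα | b ∈ B}` of `B`, as an `R`-submodule of `B`. -/
def leftMultiples (ν : ℂˣ) (α : QuantumTorus ν) :
    Submodule (QuantumTorus ν) (LocalizedTorus ν) where
  carrier := Set.range fun b : LocalizedTorus ν => b * torusInclusion ν α
  zero_mem' := ⟨0, zero_mul _⟩
  add_mem' := by
    rintro _ _ ⟨a, rfl⟩ ⟨b, rfl⟩
    exact ⟨a + b, add_mul _ _ _⟩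
  smul_mem' := by
    rintro r _ ⟨b, rfl⟩
    exact ⟨torusInclusion ν r * b, mul_assoc _ _ _⟩

/-- The `R`-module `(R + Bα)/Bα`. -/
abbrev torusQuotient (ν : ℂˣ) (α : QuantumTorus ν) : Type :=
  ↥(torusSubmodule ν ⊔ leftMultiples ν α) ⧸
    (leftMultiples ν α).submoduleOf (torusSubmodule ν ⊔ leftMultiples ν α)

/-! ### The modules `M_λ` -/

/-- The action of `x` on `M_λ = ℂ[y, y⁻¹]·1_λ`, namely `v(y)·1_λ ↦ λ v(ν⁻¹y)·1_λ`; so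
`yⁱ·1_λ ↦ λ ν⁻ⁱ yⁱ·1_λ`, as is forced by `x·1_λ = λ·1_λ` and `y x = ν x y`. -/
def weightX (ν l : ℂˣ) : (Module.End ℂ ℂ[T;T⁻¹])ˣ :=
  Units.map (algebraMap ℂ (Module.End ℂ ℂ[T;T⁻¹]) : ℂ →* Module.End ℂ ℂ[T;T⁻¹]) l *
    (LinearMap.GeneralLinearGroup.ofLinearEquiv (laurentScale ν⁻¹).toLinearEquiv)

/-- The action of `y` on `M_λ = ℂ[y, y⁻¹]·1_λ`: multiplication by `y`. -/
def weightY : (Module.End ℂ ℂ[T;T⁻¹])ˣ :=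
  Units.map (Algebra.lmul ℂ ℂ[T;T⁻¹] : ℂ[T;T⁻¹] →* Module.End ℂ ℂ[T;T⁻¹]) laurentVar

theorem weightScalar_commute (c : ℂˣ) (g : (Module.End ℂ ℂ[T;T⁻¹])ˣ) :
    Commute (Units.map (algebraMap ℂ (Module.End ℂ ℂ[T;T⁻¹]) : ℂ →* Module.End ℂ ℂ[T;T⁻¹]) c) g :=
  Units.ext (Algebra.commutes (c : ℂ) (g : Module.End ℂ ℂ[T;T⁻¹]))

theorem weight_semiconj (ν l : ℂˣ) :
    SemiconjBy weightY (weightX ν l)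
      (Units.map (algebraMap ℂ (Module.End ℂ ℂ[T;T⁻¹]) : ℂ →* Module.End ℂ ℂ[T;T⁻¹]) ν *
        weightX ν l) := by
  refine Units.ext (LinearMap.ext fun v => ?_)
  change LaurentPolynomial.T 1 * ((l : ℂ) • laurentScale ν⁻¹ v) =
    (ν : ℂ) • ((l : ℂ) • laurentScale ν⁻¹ (LaurentPolynomial.T 1 * v))
  have e : laurentScale ν⁻¹ (LaurentPolynomial.T 1)
        = (((ν⁻¹) ^ (1 : ℤ) : ℂˣ) : ℂ) • LaurentPolynomial.T 1 := laurentScaleHom_T ν⁻¹ 1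
  rw [map_mul, e, smul_mul_assoc, smul_smul, smul_smul, mul_smul_comm]
  congr 1
  rw [zpow_one, mul_comm (ν : ℂ), mul_assoc, Units.mul_inv, mul_one]

theorem weightY_mul (ν l : ℂˣ) (p : ℂ[T;T⁻¹]) :
    (weightY : Module.End ℂ ℂ[T;T⁻¹]) * laurentEval (weightX ν l) p =
      laurentEval (weightX ν l) (laurentScale ν p) * (weightY : Module.End ℂ ℂ[T;T⁻¹]) := by
  induction p using LaurentPolynomial.induction_on' with
  | add p q hp hq => simp only [map_add, mul_add, add_mul, hp, hq]
  | C_mul_T n a =>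
    have e : (LaurentPolynomial.C a * LaurentPolynomial.T n : ℂ[T;T⁻¹])
        = a • LaurentPolynomial.T n := by rw [Algebra.smul_def]; rfl
    have e'' : laurentScale ν (LaurentPolynomial.T n)
        = ((ν ^ n : ℂˣ) : ℂ) • LaurentPolynomial.T n := laurentScaleHom_T ν n
    rw [e, map_smul, map_smul, map_smul, e'', map_smul, laurentEval_T, mul_smul_comm,
      smul_mul_assoc, smul_mul_assoc]
    congr 1
    rw [← Units.val_mul, ← Units.val_mul, (weight_semiconj ν l).zpow_right n |>.eq,
      (weightScalar_commute ν _).mul_zpow, mul_assoc, Units.val_mul, ← map_zpow,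
      Algebra.smul_def]
    rfl

/-- The representation of the quantum torus on `ℂ[y, y⁻¹]·1_λ`. -/
def weightRep (ν l : ℂˣ) : QuantumTorus ν →+* Module.End ℂ ℂ[T;T⁻¹] :=
  SkewLaurent.lift _ (laurentEval (weightX ν l)).toRingHom weightY (weightY_mul ν l)

/-- The vector space `M_λ = ℂ[y, y⁻¹]·1_λ`, whose element `v(y)·1_λ` is the Laurent polynomial `v`
(in a variable which here stands for `y`). -/
def WeightModule (_ν _l : ℂˣ) : Type := ℂ[T;T⁻¹]

instance (ν l : ℂˣ) : AddCommGroup (WeightModule ν l) :=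
  inferInstanceAs (AddCommGroup ℂ[T;T⁻¹])

instance (ν l : ℂˣ) : Module (QuantumTorus ν) (WeightModule ν l) :=
  letI : Module (QuantumTorus ν) ℂ[T;T⁻¹] := Module.compHom ℂ[T;T⁻¹] (weightRep ν l)
  inferInstanceAs (Module (QuantumTorus ν) ℂ[T;T⁻¹])

end

/-! The dichotomy is whether `M` has torsion over `ℂ[x^{±1}]`. With torsion, some nonzero polynomial
in `x` kills a nonzero vector; since it splits over `ℂ`, `x` has an eigenvector `m`, with eigenvalue
`λ ≠ 0` because `x` is a unit. Modulo `R(x - λ)` every element of `R` is a finite sum `∑ zᵢ yⁱ`, and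
the vectors `yⁱ m` are eigenvectors with distinct eigenvalues `λν⁻ⁱ`, so `Ann(m) = R(x - λ)`
(`smul_eq_zero_iff_of_xSub_smul_eq_zero`). The same holds for `1_λ`, and both modules are cyclic, so
`M ≅ M_λ`. Without torsion, fix `m ≠ 0`. The left ideal `B·Ann(m)` meets `R` exactly in `Ann(m)` and
is maximal because `M` is simple (`localizedAnnihilator_isMaximal`). Left ideals of `B` are
principal by division with remainder (`exists_eq_span_singleton`), and a generator can be taken to
be some `α ∈ R`. Maximality makes `α` irreducible once `α ≠ 0`, and `M ≅ R/(R ∩ Bα) ≅ (R + Bα)/Bα`.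
-/

noncomputable section

namespace SkewLaurent

/-! ### Coefficients and leading terms in skew Laurent rings -/

section Coefficients

variable {A : Type*} [CommRing A] (σ : A ≃+* A)

/-- The coefficient of `yⁱ`. -/
def coeff (i : ℤ) : SkewLaurent A σ →+ A where
  toFun b := SkewMonoidAlgebra.coeff b (Multiplicative.ofAdd i)
  map_zero' := rfl
  map_add' b c := congrArg (fun f => f (Multiplicative.ofAdd i)) (SkewMonoidAlgebra.coeff_add b c)

@[ext]
theorem ext {b c : SkewLaurent A σ} (h : ∀ i, coeff σ i b = coeff σ i c) : b = c :=
  SkewMonoidAlgebra.ext fun i => h i.toAdd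

/-- The set of exponents that occur in an element. -/
def exponents (b : SkewLaurent A σ) : Finset ℤ :=
  (SkewMonoidAlgebra.support b).map Multiplicative.toAdd.toEmbedding

theorem mem_exponents {b : SkewLaurent A σ} {i : ℤ} : i ∈ exponents σ b ↔ coeff σ i b ≠ 0 := by
  simp only [exponents, Finset.mem_map_equiv]
  exact SkewMonoidAlgebra.mem_support_iff

/-- `monomial` as an additive homomorphism in the coefficient. -/
def monomialHom (i : ℤ) : A →+ SkewLaurent A σ where
  toFun := monomial σ i
  map_zero' := SkewMonoidAlgebra.single_zero _
  map_add' a b := SkewMonoidAlgebra.single_add _ a b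

theorem monomial_zero (i : ℤ) : monomial σ i 0 = 0 := (monomialHom σ i).map_zero

theorem monomial_add (i : ℤ) (a b : A) :
    monomial σ i (a + b) = monomial σ i a + monomial σ i b := (monomialHom σ i).map_add a b

theorem coeff_monomial (i j : ℤ) (a : A) :
    coeff σ i (monomial σ j a) = if j = i then a else 0 := by
  change (Finsupp.single (Multiplicative.ofAdd j) a) (Multiplicative.ofAdd i) = _
  rw [Finsupp.single_apply]
  simp

theorem sum_monomial_coeff (b : SkewLaurent A σ) :
    ∑ i ∈ exponents σ b, monomial σ i (coeff σ i b) = b := by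
  ext j
  rw [map_sum]
  simp only [coeff_monomial, Finset.sum_ite_eq', mem_exponents]
  by_cases h : coeff σ j b = 0 <;> simp [h, mem_exponents]

@[elab_as_elim]
theorem induction_on {p : SkewLaurent A σ → Prop} (b : SkewLaurent A σ)
    (add : ∀ b c, p b → p c → p (b + c)) (monomial : ∀ i a, p (monomial σ i a)) : p b := by
  rw [← sum_monomial_coeff σ b]
  exact Finset.sum_induction _ p add (by simpa [monomial_zero] using monomial 0 0)
    fun i _ => monomial i _

theorem coeff_monomial_mul (i n : ℤ) (a : A) (b : SkewLaurent A σ) :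
    coeff σ n (monomial σ i a * b) = a * (σ ^ i : RingAut A) (coeff σ (n - i) b) := by
  induction b using induction_on with
  | add b c hb hc => rw [mul_add, map_add, hb, hc, map_add, map_add, mul_add]
  | monomial j c =>
    rw [monomial_mul_monomial, coeff_monomial, coeff_monomial]
    have : i + j = n ↔ j = n - i := by omega
    simp only [this]
    split_ifs <;> simp

theorem coeff_mul (n : ℤ) (a b : SkewLaurent A σ) :
    coeff σ n (a * b) =
      ∑ i ∈ exponents σ a, coeff σ i a * (σ ^ i : RingAut A) (coeff σ (n - i) b) := by
  conv_lhs => rw [← sum_monomial_coeff σ a]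
  rw [Finset.sum_mul, map_sum]
  simp only [coeff_monomial_mul]

/-- Leading coefficients multiply up to a twist by an automorphism, which is why the ring is a
domain whenever `A` is. -/
theorem coeff_add_mul {a b : SkewLaurent A σ} {p q : ℤ} (ha : ∀ i, p < i → coeff σ i a = 0)
    (hb : ∀ i, q < i → coeff σ i b = 0) :
    coeff σ (p + q) (a * b) = coeff σ p a * (σ ^ p : RingAut A) (coeff σ q b) := by
  rw [coeff_mul, Finset.sum_eq_single p]
  · simp
  · intro i hi hip
    have : i < p := lt_of_le_of_ne (not_lt.mp fun h => (mem_exponents σ).mp hi (ha i h)) hip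
    rw [hb _ (by omega), map_zero, mul_zero]
  · intro h
    rw [mem_exponents, not_not] at h
    rw [h, zero_mul]

theorem exists_leading {a : SkewLaurent A σ} (ha : a ≠ 0) :
    ∃ p, coeff σ p a ≠ 0 ∧ ∀ i, p < i → coeff σ i a = 0 := by
  have hne : (exponents σ a).Nonempty := by
    rw [Finset.nonempty_iff_ne_empty]
    intro h
    apply ha
    rw [← sum_monomial_coeff σ a, h, Finset.sum_empty]
  refine ⟨_, (mem_exponents σ).mp ((exponents σ a).max'_mem hne), fun i hi => ?_⟩
  by_contra h
  exact absurd ((exponents σ a).le_max' i ((mem_exponents σ).mpr h)) (not_le.mpr hi)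

instance [IsDomain A] : NoZeroDivisors (SkewLaurent A σ) where
  eq_zero_or_eq_zero_of_mul_eq_zero {a b} h := by
    by_contra! hab
    obtain ⟨p, hp, hp'⟩ := exists_leading σ hab.1
    obtain ⟨q, hq, hq'⟩ := exists_leading σ hab.2
    have := coeff_add_mul σ hp' hq'
    rw [h, map_zero, eq_comm, mul_eq_zero, map_eq_zero_iff _ (RingEquiv.injective _)] at this
    exact this.elim hp hq

instance [Nontrivial A] : Nontrivial (SkewLaurent A σ) :=
  inferInstanceAs (Nontrivial (SkewMonoidAlgebra A (Multiplicative ℤ)))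

instance [IsDomain A] : IsDomain (SkewLaurent A σ) := NoZeroDivisors.to_isDomain _

theorem y_zpow (i : ℤ) : ((y σ ^ i : (SkewLaurent A σ)ˣ) : SkewLaurent A σ) = monomial σ i 1 := by
  induction i with
  | zero => exact (monomial_zero_one σ).symm
  | succ n ih =>
    rw [zpow_add_one, Units.val_mul, ih]
    exact (monomial_mul_monomial σ _ _ _ _).trans (by simp)
  | pred n ih =>
    rw [zpow_sub_one, Units.val_mul, ih]
    exact (monomial_mul_monomial σ _ _ _ _).trans (by simp [sub_eq_add_neg])

theorem monomial_eq (i : ℤ) (a : A) :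
    monomial σ i a = coeffHom σ a * ((y σ ^ i : (SkewLaurent A σ)ˣ) : SkewLaurent A σ) := by
  rw [y_zpow]
  exact ((monomial_mul_monomial σ 0 i a 1).trans (by simp)).symm

theorem monomial_eq' (i : ℤ) (a : A) :
    monomial σ i a = ((y σ ^ i : (SkewLaurent A σ)ˣ) : SkewLaurent A σ) *
      coeffHom σ ((σ ^ (-i) : RingAut A) a) := by
  rw [y_zpow]
  refine ((monomial_mul_monomial σ i 0 1 _).trans ?_).symm
  rw [← RingAut.mul_apply, ← zpow_add]
  simp

theorem lift_monomial {D : Type*} [Ring D] (f : A →+* D) (u : Dˣ)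
    (h : ∀ a, (u : D) * f a = f (σ a) * u) (i : ℤ) (a : A) :
    lift σ f u h (monomial σ i a) = f a * ((u ^ i : Dˣ) : D) := by
  let := cyclicAction σ
  exact SkewMonoidAlgebra.liftNC_single (f : A →+ D) _ _ _

theorem lift_coeffHom {D : Type*} [Ring D] (f : A →+* D) (u : Dˣ)
    (h : ∀ a, (u : D) * f a = f (σ a) * u) (a : A) :
    lift σ f u h (coeffHom σ a) = f a :=
  (lift_monomial σ f u h 0 a).trans (by simp)

end Coefficients

/-! ### Division with remainder over a field -/

section Field

variable {K : Type*} [Field K] (σ : K ≃+* K)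

/-- The exponents of `b` lie in the interval `[k, k + n)`. -/
def SupportedIn (b : SkewLaurent K σ) (k : ℤ) (n : ℕ) : Prop :=
  ∀ i, coeff σ i b ≠ 0 → k ≤ i ∧ i < k + n

theorem exists_supportedIn (b : SkewLaurent K σ) : ∃ k n, SupportedIn σ b k n := by
  obtain ⟨k, hk⟩ := (exponents σ b).bddBelow
  obtain ⟨l, hl⟩ := (exponents σ b).bddAbove
  refine ⟨k, (l + 1 - k).toNat, fun i hi => ?_⟩
  have h₁ := hk ((mem_exponents σ).mpr hi)
  have h₂ := hl ((mem_exponents σ).mpr hi)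
  omega

theorem eq_zero_of_supportedIn_zero {b : SkewLaurent K σ} {k : ℤ} (h : SupportedIn σ b k 0) :
    b = 0 := by
  ext i
  by_contra hi
  have := h i hi
  omega

/-- Every left ideal of a skew Laurent polynomial ring over a field is principal. -/
theorem exists_eq_span_singleton (J : Ideal (SkewLaurent K σ)) : ∃ a, J = Ideal.span {a} := by
  classical
  by_cases hJ : ∀ b ∈ J, b = 0
  · exact ⟨0, by rw [Ideal.span_singleton_zero]; exact (Submodule.eq_bot_iff J).mpr hJ⟩
  push Not at hJ
  have hex : ∃ n, ∃ a ∈ J, a ≠ 0 ∧ ∃ k, SupportedIn σ a k n := by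
    obtain ⟨b, hb, hb0⟩ := hJ
    obtain ⟨k, n, h⟩ := exists_supportedIn σ b
    exact ⟨n, b, hb, hb0, k, h⟩
  -- As `y` is a unit, only the width of the exponent interval matters; it plays the role of the
  -- degree, and a nonzero element of least width generates.
  obtain ⟨a, haJ, ha0, k, ha⟩ := Nat.find_spec hex
  have hmin : ∀ m < Nat.find hex, ∀ b ∈ J, ∀ l, SupportedIn σ b l m → b = 0 := by
    intro m hm b hb l hl
    by_contra h
    exact Nat.find_min hex hm ⟨b, hb, h, l, hl⟩
  generalize Nat.find hex = n at ha hmin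
  obtain _ | n := n
  · exact absurd (eq_zero_of_supportedIn_zero σ ha) ha0
  have htop : coeff σ (k + n) a ≠ 0 := by
    intro h0
    refine ha0 (hmin n n.lt_succ_self a haJ k fun i hi => ?_)
    have h₁ := ha i hi
    have h₂ : i ≠ k + n := by rintro rfl; exact hi h0
    push_cast at h₁
    omega
  refine ⟨a, le_antisymm ?_ ((Ideal.span_singleton_le_iff_mem J).mpr haJ)⟩
  have key : ∀ N : ℕ, ∀ b ∈ J, ∀ l, SupportedIn σ b l N → b ∈ Ideal.span {a} := by
    intro N
    induction N with
    | zero =>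
      intro b _ l hl
      rw [eq_zero_of_supportedIn_zero σ hl]
      exact zero_mem _
    | succ N ih =>
      intro b hb l hl
      by_cases hN : N < n
      · rw [hmin (N + 1) (by omega) b hb l hl]
        exact zero_mem _
      -- The shift `j` aligns the top exponent `k + n` of `a` with `l + N`, and `c` cancels the top
      -- coefficient of `b`. As `n ≤ N`, the shifted `a` does not reach below `l`, so the width
      -- drops to `N`.
      set j : ℤ := l + N - (k + n) with hj
      set c : K := coeff σ (l + N) b / (σ ^ j : RingAut K) (coeff σ (k + n) a) with hc
      have hmem : monomial σ j c * a ∈ Ideal.span {a} :=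
        Ideal.mul_mem_left _ _ (Ideal.mem_span_singleton_self a)
      have hmemJ : monomial σ j c * a ∈ J := Ideal.mul_mem_left _ _ haJ
      rw [← sub_add_cancel b (monomial σ j c * a)]
      refine add_mem (ih _ (sub_mem hb hmemJ) l fun i hi => ?_) hmem
      rw [map_sub, coeff_monomial_mul] at hi
      have hiN : i ≠ l + N := by
        rintro rfl
        apply hi
        have : l + N - j = k + n := by omega
        rw [this, hc, div_mul_cancel₀, sub_self]
        exact (map_ne_zero_iff _ (RingEquiv.injective _)).mpr htop
      by_cases hbi : coeff σ i b = 0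
      · have : coeff σ (i - j) a ≠ 0 := by
          intro h0
          apply hi
          rw [hbi, h0, map_zero, mul_zero, sub_zero]
        have := ha _ this
        push_cast at this
        omega
      · have := hl i hbi
        push_cast at this
        omega
  intro b hb
  obtain ⟨l, N, h⟩ := exists_supportedIn σ b
  exact key N b hb l h

end Field

end SkewLaurent

/-! ### Maximal principal left ideals, and Laurent polynomials as rational functions -/

/-- In a domain, a nonzero element that generates a maximal left ideal is irreducible. -/
theorem irreducible_of_isMaximal_span {D : Type*} [Ring D] [IsDomain D] {a : D} (ha : a ≠ 0)
    (h : (Ideal.span {a}).IsMaximal) : Irreducible a := by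
  -- In a domain one-sided inverses are two-sided.
  have unit_of_mul : ∀ {c d : D}, d * c = 1 → IsUnit c := fun {c d} hdc =>
    ⟨⟨c, d, mul_eq_one_comm.mp hdc, hdc⟩, rfl⟩
  refine ⟨fun hu => h.ne_top ?_, fun b c hbc => ?_⟩
  · obtain ⟨u, rfl⟩ := hu
    rw [Ideal.eq_top_iff_one]
    exact Ideal.mem_span_singleton'.mpr ⟨_, u.inv_mul⟩
  -- If `c = da`, then `c = dbc`, so `db = 1`. Otherwise `Dc` strictly contains the maximal `Da`,
  -- hence is everything.
  by_cases hc : c ∈ Ideal.span {a}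
  · obtain ⟨d, hd⟩ := Ideal.mem_span_singleton'.mp hc
    have hc0 : c ≠ 0 := by rintro rfl; exact ha (by rw [hbc, mul_zero])
    left
    refine unit_of_mul (d := d) (mul_right_cancel₀ hc0 ?_)
    rw [mul_assoc, ← hbc, hd, one_mul]
  · right
    have hle : Ideal.span {a} ≤ Ideal.span {c} :=
      (Ideal.span_singleton_le_iff_mem _).mpr (Ideal.mem_span_singleton'.mpr ⟨b, hbc.symm⟩)
    have htop := h.1.2 _ (lt_of_le_of_ne hle fun he =>
      hc (he ▸ Ideal.mem_span_singleton_self c))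
    obtain ⟨d, hd⟩ := Ideal.mem_span_singleton'.mp ((Ideal.eq_top_iff_one _).mp htop)
    exact unit_of_mul hd

theorem laurentEval_toLaurent {D : Type*} [Ring D] [Algebra ℂ D] (u : Dˣ) (f : ℂ[X]) :
    laurentEval u (Polynomial.toLaurent f) = Polynomial.aeval (u : D) f := by
  have : (laurentEval u).comp Polynomial.toLaurentAlg = Polynomial.aeval (u : D) := by
    refine Polynomial.algHom_ext ?_
    simp [laurentEval_T]
  exact DFunLike.congr_fun this f

theorem laurentToRatFunc_toLaurent (f : ℂ[X]) :
    laurentToRatFunc (Polynomial.toLaurent f) = algebraMap ℂ[X] (RatFunc ℂ) f := by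
  refine (laurentEval_toLaurent _ f).trans ?_
  rw [Units.val_mk0, ← RatFunc.algebraMap_X, Polynomial.aeval_algebraMap_apply,
    Polynomial.aeval_X_left_apply]

theorem laurentToRatFunc_injective : Function.Injective laurentToRatFunc := by
  rw [injective_iff_map_eq_zero]
  intro p hp
  obtain ⟨n, f, hf⟩ := LaurentPolynomial.exists_T_pow p
  have h : laurentToRatFunc (Polynomial.toLaurent f) = 0 := by rw [hf, map_mul, hp, zero_mul]
  rw [laurentToRatFunc_toLaurent, map_eq_zero_iff _ (IsFractionRing.injective _ _)] at h
  rw [h, map_zero] at hf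
  exact ((LaurentPolynomial.isUnit_T (n : ℤ)).mul_left_eq_zero).mp hf.symm

/-! ### The quantum torus inside its localization -/

namespace QuantumTorus

open SkewLaurent

variable (ν : ℂˣ)

/-- The element `p(x)` of the quantum torus. -/
abbrev ofLaurent : ℂ[T;T⁻¹] →+* QuantumTorus ν := coeffHom (laurentScale ν).toRingEquiv

theorem inclusion_monomial (i : ℤ) (p : ℂ[T;T⁻¹]) :
    torusInclusion ν (monomial _ i p) = monomial _ i (laurentToRatFunc p) := by
  rw [monomial_eq (ratFuncScale ν)]
  exact lift_monomial _ _ _ _ i p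

theorem inclusion_ofLaurent (p : ℂ[T;T⁻¹]) :
    torusInclusion ν (ofLaurent ν p) = coeffHom (ratFuncScale ν) (laurentToRatFunc p) :=
  inclusion_monomial ν 0 p

theorem coeff_inclusion (i : ℤ) (r : QuantumTorus ν) :
    coeff _ i (torusInclusion ν r) = laurentToRatFunc (coeff _ i r) := by
  induction r using SkewLaurent.induction_on with
  | add b c hb hc => simp only [map_add, hb, hc]
  | monomial j p =>
    rw [inclusion_monomial, coeff_monomial, coeff_monomial]
    split_ifs <;> simp

theorem inclusion_injective : Function.Injective (torusInclusion ν) := by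
  intro r s h
  ext1 i
  apply laurentToRatFunc_injective
  rw [← coeff_inclusion, ← coeff_inclusion, h]

theorem isUnit_inclusion_ofLaurent {s : ℂ[T;T⁻¹]} (hs : s ≠ 0) :
    IsUnit (torusInclusion ν (ofLaurent ν s)) := by
  rw [inclusion_ofLaurent]
  refine IsUnit.map _ (isUnit_iff_ne_zero.mpr ?_)
  rwa [map_ne_zero_iff _ laurentToRatFunc_injective]

theorem exists_denominator (b : LocalizedTorus ν) :
    ∃ s : ℂ[T;T⁻¹], s ≠ 0 ∧ ∃ r, torusInclusion ν (ofLaurent ν s) * b = torusInclusion ν r := by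
  induction b using SkewLaurent.induction_on with
  | add b c hb hc =>
    obtain ⟨s, hs, r, hr⟩ := hb
    obtain ⟨t, ht, q, hq⟩ := hc
    refine ⟨s * t, mul_ne_zero hs ht, ofLaurent ν t * r + ofLaurent ν s * q, ?_⟩
    rw [mul_add, map_add, map_mul (torusInclusion ν), map_mul (torusInclusion ν), ← hr, ← hq,
      ← mul_assoc, ← mul_assoc, ← map_mul, ← map_mul, ← map_mul, ← map_mul, mul_comm t s]
  | monomial i f =>
    obtain ⟨p, q, hq, rfl⟩ := IsFractionRing.div_surjective (A := ℂ[X]) f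
    have hq0 : q ≠ 0 := nonZeroDivisors.ne_zero hq
    refine ⟨Polynomial.toLaurent q, Polynomial.toLaurent_ne_zero.mpr hq0,
      monomial _ i (Polynomial.toLaurent p), ?_⟩
    rw [inclusion_monomial, inclusion_ofLaurent, monomial_eq, monomial_eq, ← mul_assoc, ← map_mul,
      laurentToRatFunc_toLaurent, laurentToRatFunc_toLaurent, mul_div_cancel₀]
    rwa [map_ne_zero_iff _ (IsFractionRing.injective ℂ[X] (RatFunc ℂ))]

/-- The inclusion `R → B` as a homomorphism of left `R`-modules. -/
def inclusionLinear : QuantumTorus ν →ₗ[QuantumTorus ν] LocalizedTorus ν where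
  toFun := torusInclusion ν
  map_add' := (torusInclusion ν).map_add
  map_smul' := (torusInclusion ν).map_mul

/-! ### The torsion-free case -/

section Localization

variable {ν} {M : Type*} [AddCommGroup M] [Module (QuantumTorus ν) M]

/-- The left ideal `B·Ann(m)` of the localization. -/
def localizedAnnihilator (m : M) : Ideal (LocalizedTorus ν) where
  carrier := {b | ∃ s : ℂ[T;T⁻¹], s ≠ 0 ∧ ∃ r : QuantumTorus ν, r • m = 0 ∧
    torusInclusion ν (ofLaurent ν s) * b = torusInclusion ν r}
  zero_mem' := ⟨1, one_ne_zero, 0, zero_smul _ _, by simp⟩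
  add_mem' := by
    rintro b c ⟨s, hs, r, hrm, hr⟩ ⟨t, ht, q, hqm, hq⟩
    refine ⟨s * t, mul_ne_zero hs ht, ofLaurent ν t * r + ofLaurent ν s * q, ?_, ?_⟩
    · rw [add_smul, mul_smul, mul_smul, hrm, hqm, smul_zero, smul_zero, add_zero]
    · rw [mul_add, map_add, map_mul (torusInclusion ν), map_mul (torusInclusion ν), ← hr, ← hq,
        ← mul_assoc, ← mul_assoc, ← map_mul, ← map_mul, ← map_mul, ← map_mul, mul_comm t s]
  smul_mem' := by
    rintro c b ⟨s, hs, r, hrm, hr⟩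
    obtain ⟨u, hu⟩ := isUnit_inclusion_ofLaurent ν hs
    -- Here `b = s⁻¹r`, so `cb = (cs⁻¹)r`; clearing the left denominator of `cs⁻¹` gives `t·cb =
    -- qr`, which still kills `m`.
    obtain ⟨t, ht, q, hq⟩ := exists_denominator ν (c * ((u⁻¹ : (LocalizedTorus ν)ˣ) : LocalizedTorus ν))
    refine ⟨t, ht, q * r, by rw [mul_smul, hrm, smul_zero], ?_⟩
    rw [map_mul, ← hq, ← hr, ← hu, mul_assoc, mul_assoc, Units.inv_mul_cancel_left, smul_eq_mul]

/-- From `sr ∈ Ann(m)` torsion-freeness cancels `s`, so localizing adds no new relations from `R`.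
-/
theorem inclusion_mem_localizedAnnihilator {m : M}
    (hfree : ∀ s : ℂ[T;T⁻¹], s ≠ 0 → ∀ n : M, ofLaurent ν s • n = 0 → n = 0)
    {r : QuantumTorus ν} : torusInclusion ν r ∈ localizedAnnihilator m ↔ r • m = 0 := by
  refine ⟨?_, fun h => ⟨1, one_ne_zero, r, h, by simp⟩⟩
  rintro ⟨s, hs, q, hqm, hq⟩
  rw [← map_mul] at hq
  refine hfree s hs _ ?_
  rw [← mul_smul, inclusion_injective ν hq, hqm]

/-- An element outside the ideal has a numerator `r` with `rm ≠ 0`. Simplicity gives `qrm = m`, and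
then `1 = (1 - qr) + qr` lies in any strictly larger left ideal. -/
theorem localizedAnnihilator_isMaximal [IsSimpleModule (QuantumTorus ν) M] {m : M} (hm : m ≠ 0)
    (hfree : ∀ s : ℂ[T;T⁻¹], s ≠ 0 → ∀ n : M, ofLaurent ν s • n = 0 → n = 0) :
    (localizedAnnihilator (ν := ν) m).IsMaximal := by
  refine ⟨⟨?_, fun K hK => ?_⟩⟩
  · rw [Ne, Ideal.eq_top_iff_one, ← map_one (torusInclusion ν),
      inclusion_mem_localizedAnnihilator hfree, one_smul]
    exact hm
  obtain ⟨hle, k, hkK, hk⟩ := SetLike.lt_iff_le_and_exists.mp hK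
  obtain ⟨s, hs, r, hr⟩ := exists_denominator ν k
  have hrm : r • m ≠ 0 := fun h => hk ⟨s, hs, r, h, hr⟩
  obtain ⟨q, hq⟩ := IsSimpleModule.toSpanSingleton_surjective (QuantumTorus ν) hrm m
  rw [LinearMap.toSpanSingleton_apply, ← mul_smul] at hq
  have h₁ : torusInclusion ν (1 - q * r) ∈ K :=
    hle ((inclusion_mem_localizedAnnihilator hfree).mpr (by rw [sub_smul, one_smul, hq, sub_self]))
  have h₂ : torusInclusion ν (q * r) ∈ K := by
    rw [map_mul, ← hr]
    exact Ideal.mul_mem_left _ _ (Ideal.mul_mem_left _ _ hkK)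
  rw [Ideal.eq_top_iff_one, ← map_one (torusInclusion ν)]
  convert add_mem h₁ h₂ using 1
  rw [← map_add, sub_add_cancel]

/-- Clearing the denominator of a generator multiplies it on the left by a unit of `B`, which leaves
the left ideal unchanged. -/
theorem exists_localizedAnnihilator_eq_span (m : M) :
    ∃ α : QuantumTorus ν, α • m = 0 ∧ localizedAnnihilator m = Ideal.span {torusInclusion ν α} := by
  obtain ⟨β, hβ⟩ := exists_eq_span_singleton (ratFuncScale ν) (localizedAnnihilator m)
  obtain ⟨s, hs, α, hα, h⟩ : β ∈ localizedAnnihilator m := by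
    rw [hβ]
    exact Ideal.mem_span_singleton_self β
  refine ⟨α, hα, hβ.trans ?_⟩
  rw [← h]
  obtain ⟨u, hu⟩ := isUnit_inclusion_ofLaurent ν hs
  rw [← hu]
  refine le_antisymm ?_ ?_ <;> rw [Ideal.span_singleton_le_iff_mem, Ideal.mem_span_singleton']
  · exact ⟨((u⁻¹ : (LocalizedTorus ν)ˣ) : LocalizedTorus ν), u.inv_mul_cancel_left β⟩
  · exact ⟨u, rfl⟩

/-- A quotient of the quantum torus is `(R + Bα)/Bα` if its relations are `R ∩ Bα`. -/
theorem nonempty_equiv_torusQuotient [IsSimpleModule (QuantumTorus ν) M] {m : M} (hm : m ≠ 0)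
    {α : QuantumTorus ν}
    (h : ∀ r : QuantumTorus ν, torusInclusion ν r ∈ Ideal.span {torusInclusion ν α} ↔ r • m = 0) :
    Nonempty (M ≃ₗ[QuantumTorus ν] torusQuotient ν α) := by
  let f : QuantumTorus ν →ₗ[QuantumTorus ν] torusQuotient ν α :=
    (Submodule.mkQ _).comp
      ((inclusionLinear ν).codRestrict (torusSubmodule ν ⊔ leftMultiples ν α)
        fun r => Submodule.mem_sup_left ⟨r, rfl⟩)
  have hf : Function.Surjective f := by
    intro z
    obtain ⟨⟨b, hb⟩, rfl⟩ := Submodule.mkQ_surjective _ z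
    obtain ⟨_, ⟨r, rfl⟩, c, hc, rfl⟩ := Submodule.mem_sup.mp hb
    refine ⟨r, (Submodule.Quotient.eq _).mpr ?_⟩
    rw [Submodule.submoduleOf, Submodule.mem_comap]
    change torusInclusion ν r - (torusInclusion ν r + c) ∈ _
    rw [sub_add_cancel_left]
    exact neg_mem hc
  have hker : LinearMap.ker (LinearMap.toSpanSingleton (QuantumTorus ν) M m) = LinearMap.ker f := by
    ext r
    rw [LinearMap.mem_ker, LinearMap.mem_ker, LinearMap.toSpanSingleton_apply, ← h,
      Ideal.mem_span_singleton']
    refine Iff.trans ?_ (Submodule.Quotient.mk_eq_zero _).symm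
    rw [Submodule.submoduleOf, Submodule.mem_comap]
    exact Iff.rfl
  exact ⟨((LinearMap.quotKerEquivOfSurjective _
    (IsSimpleModule.toSpanSingleton_surjective _ hm)).symm.trans
      (Submodule.quotEquivOfEq _ _ hker)).trans (LinearMap.quotKerEquivOfSurjective f hf)⟩

end Localization

end QuantumTorus

/-! ### The torsion case: weight vectors and `M_λ` -/

namespace QuantumTorus

open SkewLaurent LaurentPolynomial

theorem exists_eq_mul_sub_add (l : ℂˣ) (p : ℂ[T;T⁻¹]) :
    ∃ q : ℂ[T;T⁻¹], ∃ z : ℂ, p = q * (T 1 - C (l : ℂ)) + C z := by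
  have hl : (C (l : ℂ) : ℂ[T;T⁻¹]) * C ((l⁻¹ : ℂˣ) : ℂ) = 1 := by
    rw [← map_mul, Units.mul_inv, map_one]
  have hT : (T 1 : ℂ[T;T⁻¹]) * T (-1) = 1 := by rw [← T_add]; simp
  induction p using LaurentPolynomial.induction_on with
  | h_C a => exact ⟨0, a, by simp⟩
  | h_add hp hq =>
    obtain ⟨q, z, rfl⟩ := hp
    obtain ⟨q', z', rfl⟩ := hq
    exact ⟨q + q', z + z', by rw [map_add]; ring⟩
  | h_C_mul_T n a ih =>
    obtain ⟨q, z, h⟩ := ih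
    refine ⟨q * T 1 + C z, z * l, ?_⟩
    rw [T_add, ← mul_assoc, h, map_mul]
    ring
  | h_C_mul_T_Z n a ih =>
    obtain ⟨q, z, h⟩ := ih
    refine ⟨q * T (-1) - C z * C ((l⁻¹ : ℂˣ) : ℂ) * T (-1), z * ((l⁻¹ : ℂˣ) : ℂ), ?_⟩
    rw [sub_eq_add_neg, T_add, ← mul_assoc, h, map_mul]
    linear_combination (-C z * T (-1)) * hl + C z * C ((l⁻¹ : ℂˣ) : ℂ) * hT

theorem laurentScale_zpow_C (ν : ℂˣ) (i : ℤ) (z : ℂ) :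
    ((laurentScale ν).toRingEquiv ^ i : RingAut ℂ[T;T⁻¹]) (C z) = C z := by
  have h : (laurentScale ν).toRingEquiv ∈ MulAction.stabilizer (RingAut ℂ[T;T⁻¹]) (C z : ℂ[T;T⁻¹]) :=
    (laurentScale ν).commutes z
  exact zpow_mem h i

theorem laurentScale_zpow_T (ν : ℂˣ) (i : ℤ) :
    ((laurentScale ν).toRingEquiv ^ i : RingAut ℂ[T;T⁻¹]) (T 1) =
      C ((ν ^ i : ℂˣ) : ℂ) * T 1 := by
  have h : ∀ c : ℂˣ, (laurentScale c) (T 1) = C (c : ℂ) * T 1 := fun c => by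
    have := laurentScaleHom_T c 1
    rw [zpow_one, Algebra.smul_def] at this
    exact this
  induction i with
  | zero => simp
  | succ n ih =>
    rw [zpow_add_one, RingAut.mul_apply, zpow_add_one]
    refine (congrArg _ (h ν)).trans ?_
    rw [map_mul, laurentScale_zpow_C, ih, Units.val_mul, map_mul]
    ring
  | pred n ih =>
    rw [zpow_sub_one, RingAut.mul_apply, zpow_sub_one]
    refine (congrArg _ (h ν⁻¹ : (laurentScale ν).symm (T 1) = _)).trans ?_
    rw [map_mul, laurentScale_zpow_C, ih, Units.val_mul, map_mul]
    ring

variable (ν : ℂˣ)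

/-- The element `x - l` of the quantum torus. -/
abbrev xSub (l : ℂˣ) : QuantumTorus ν := ofLaurent ν (T 1 - C (l : ℂ))

theorem exists_eq_mul_xSub_add (l : ℂˣ) (r : QuantumTorus ν) :
    ∃ q : QuantumTorus ν, ∃ c : ℤ →₀ ℂ,
      r = q * xSub ν l + c.sum fun i z => monomial _ i (C z) := by
  induction r using SkewLaurent.induction_on with
  | add r s hr hs =>
    obtain ⟨q, c, rfl⟩ := hr
    obtain ⟨q', c', rfl⟩ := hs
    refine ⟨q + q', c + c', ?_⟩
    rw [Finsupp.sum_add_index' (fun i => by rw [map_zero, monomial_zero])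
      fun i a b => by rw [map_add, monomial_add], add_mul]
    abel
  | monomial i p =>
    -- The divisor `x - l` stands on the right, so the coefficient is first moved to the right of
    -- `yⁱ`, which twists it by `σ⁻ⁱ`.
    obtain ⟨q, z, h⟩ := exists_eq_mul_sub_add l
      (((laurentScale ν).toRingEquiv ^ (-i) : RingAut ℂ[T;T⁻¹]) p)
    refine ⟨monomial _ i 1 * ofLaurent ν q, Finsupp.single i z, ?_⟩
    rw [Finsupp.sum_single_index (by rw [map_zero, monomial_zero]), monomial_eq', y_zpow, h,
      map_add, mul_add, map_mul, mul_assoc]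
    congr 1
    refine (monomial_mul_monomial _ i 0 _ _).trans ?_
    rw [laurentScale_zpow_C, add_zero, one_mul]

variable {ν} {M : Type*} [AddCommGroup M] [Module (QuantumTorus ν) M]

theorem monomial_smul_ne_zero (i : ℤ) {m : M} (hm : m ≠ 0) :
    (monomial _ i 1 : QuantumTorus ν) • m ≠ 0 := by
  intro h
  have := congrArg (fun n => (monomial _ (-i) 1 : QuantumTorus ν) • n) h
  simp only [smul_zero, ← mul_smul, monomial_mul_monomial, map_one, mul_one, neg_add_cancel,
    monomial_zero_one, one_smul] at this
  exact hm this

theorem monomial_C (i : ℤ) (z : ℂ) :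
    (monomial _ i (C z) : QuantumTorus ν) = ofLaurent ν (C z) * monomial _ i 1 :=
  ((monomial_mul_monomial _ 0 i _ _).trans (by simp)).symm

theorem ofLaurent_T_mul_monomial (i : ℤ) :
    ofLaurent ν (T 1) * monomial _ i 1 =
      ofLaurent ν (C ((ν ^ (-i) : ℂˣ) : ℂ)) * (monomial _ i 1 * ofLaurent ν (T 1)) := by
  have h₁ : ofLaurent ν (T 1) * monomial _ i 1 = monomial _ i (T 1) :=
    (monomial_mul_monomial _ 0 i _ _).trans (by simp)
  have h₂ : monomial _ i 1 * ofLaurent ν (T 1) = monomial _ i (C ((ν ^ i : ℂˣ) : ℂ) * T 1) :=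
    (monomial_mul_monomial _ i 0 _ _).trans (by simp [laurentScale_zpow_T])
  rw [h₁, h₂]
  refine ((monomial_mul_monomial _ 0 i _ _).trans ?_).symm
  rw [zpow_zero, RingAut.one_apply, ← mul_assoc, ← map_mul, ← Units.val_mul, ← zpow_add]
  simp

/-- If `ν` is not a root of unity, the annihilator of a weight vector is generated by `x - l`. -/
theorem smul_eq_zero_iff_of_xSub_smul_eq_zero (hν : ∀ n : ℕ, 0 < n → ν ^ n ≠ 1) {l : ℂˣ} {m : M}
    (hm : m ≠ 0) (hl : xSub ν l • m = 0) (r : QuantumTorus ν) :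
    r • m = 0 ↔ r ∈ Ideal.span {xSub ν l} := by
  rw [Ideal.mem_span_singleton']
  constructor
  swap
  · rintro ⟨q, rfl⟩
    rw [mul_smul, hl, smul_zero]
  intro hr
  obtain ⟨q, c, rfl⟩ := exists_eq_mul_xSub_add ν l r
  rw [add_smul, mul_smul, hl, smul_zero, zero_add] at hr
  let : Module ℂ M := Module.compHom M ((ofLaurent ν).comp C)
  have hsmul : ∀ (z : ℂ) (n : M), z • n = ofLaurent ν (C z) • n := fun _ _ => rfl
  let f : Module.End ℂ M :=
    { toFun := fun n => ofLaurent ν (T 1) • n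
      map_add' := smul_add _
      map_smul' := fun z n => by
        rw [RingHom.id_apply, hsmul, hsmul, ← mul_smul, ← mul_smul, ← map_mul, ← map_mul,
          mul_comm] }
  have hxm : ofLaurent ν (T 1) • m = (l : ℂ) • m := by
    rw [hsmul, ← sub_eq_zero, ← sub_smul, ← map_sub]
    exact hl
  let v : ℤ → M := fun i => (monomial _ i 1 : QuantumTorus ν) • m
  have hcomm : ∀ i (z : ℂ), (monomial _ i 1 : QuantumTorus ν) • z • m = z • v i := by
    intro i z
    rw [hsmul, hsmul, ← mul_smul, ← mul_smul, ← monomial_C]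
    congr 1
    refine (monomial_mul_monomial _ i 0 _ _).trans ?_
    rw [laurentScale_zpow_C, add_zero, one_mul]
  have hv : ∀ i, f.HasEigenvector (((ν ^ (-i) * l : ℂˣ)) : ℂ) (v i) := by
    intro i
    refine ⟨Module.End.mem_eigenspace_iff.mpr ?_, monomial_smul_ne_zero i hm⟩
    change ofLaurent ν (T 1) • (monomial _ i 1 : QuantumTorus ν) • m = _
    rw [← mul_smul, ofLaurent_T_mul_monomial, mul_smul, mul_smul, hxm, hcomm, ← hsmul, smul_smul,
      Units.val_mul]
  -- Genericity of `ν` enters here: the eigenvalues `λν⁻ⁱ` are pairwise distinct.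
  have hinj : Function.Injective fun i : ℤ => (((ν ^ (-i) * l : ℂˣ)) : ℂ) := by
    intro i j hij
    have h : ν ^ (-i) = ν ^ (-j) := mul_right_cancel (Units.ext hij)
    have hfin : ¬IsOfFinOrder ν := by
      rw [isOfFinOrder_iff_pow_eq_one]
      rintro ⟨n, hn, h⟩
      exact hν n hn h
    exact neg_injective (injective_zpow_iff_not_isOfFinOrder.mpr hfin h)
  have hli := Module.End.eigenvectors_linearIndependent' f _ hinj v hv
  have hc : c = 0 := by
    refine linearIndependent_iff.mp hli c ?_
    rw [Finsupp.linearCombination_apply, ← hr, Finsupp.sum, Finsupp.sum, Finset.sum_smul]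
    exact Finset.sum_congr rfl fun i _ => by rw [monomial_C, mul_smul, hsmul]
  exact ⟨q, by rw [hc, Finsupp.sum_zero_index, add_zero]⟩

theorem exists_xSub_smul_eq_zero {s : ℂ[T;T⁻¹]} (hs : s ≠ 0) {m : M} (hm : m ≠ 0)
    (h : ofLaurent ν s • m = 0) : ∃ l : ℂˣ, ∃ n : M, n ≠ 0 ∧ xSub ν l • n = 0 := by
  let g : ℂ[X] →+* QuantumTorus ν := (ofLaurent ν).comp Polynomial.toLaurent
  obtain ⟨k, f, hf⟩ := LaurentPolynomial.exists_T_pow s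
  have hf0 : f ≠ 0 := by
    rintro rfl
    rw [map_zero] at hf
    exact hs (((LaurentPolynomial.isUnit_T (k : ℤ)).mul_left_eq_zero).mp hf.symm)
  have hfm : g f • m = 0 := by
    change ofLaurent ν (Polynomial.toLaurent f) • m = 0
    rw [hf, mul_comm, map_mul, mul_smul, h, smul_zero]
  -- Peel off one linear factor at a time: either the remaining product already kills `m`, or it
  -- sends `m` to a vector killed by the current factor.
  have key : ∀ (t : Multiset ℂ) (m : M), m ≠ 0 →
      g (t.map fun a => Polynomial.X - Polynomial.C a).prod • m = 0 →
      ∃ a : ℂ, ∃ n : M, n ≠ 0 ∧ g (Polynomial.X - Polynomial.C a) • n = 0 := by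
    intro t
    induction t using Multiset.induction with
    | empty =>
      intro m hm h
      rw [Multiset.map_zero, Multiset.prod_zero, map_one, one_smul] at h
      exact absurd h hm
    | cons a t ih =>
      intro m hm h
      rw [Multiset.map_cons, Multiset.prod_cons, map_mul, mul_smul] at h
      by_cases h0 : g (t.map fun a => Polynomial.X - Polynomial.C a).prod • m = 0
      · exact ih m hm h0
      · exact ⟨a, _, h0, h⟩
  obtain ⟨a, n, hn, han⟩ := key f.roots m hm (by
    have hsplit := (IsAlgClosed.splits f).eq_prod_roots
    have hlead : f.leadingCoeff ≠ 0 := Polynomial.leadingCoeff_ne_zero.mpr hf0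
    have : (f.roots.map fun a => Polynomial.X - Polynomial.C a).prod =
        Polynomial.C f.leadingCoeff⁻¹ * f := by
      conv_rhs => rhs; rw [hsplit]
      rw [← mul_assoc, ← Polynomial.C_mul, inv_mul_cancel₀ hlead, Polynomial.C_1, one_mul]
    rw [this, map_mul, mul_smul, hfm, smul_zero])
  have ha : a ≠ 0 := by
    rintro rfl
    apply hn
    have h' : ofLaurent ν (T 1) • n = 0 := by simpa [g] using han
    exact (((LaurentPolynomial.isUnit_T 1).map (ofLaurent ν)).smul_eq_zero).mp h'
  refine ⟨Units.mk0 a ha, n, hn, ?_⟩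
  simpa [g] using han

variable (ν) in
/-- The generator `1_λ` of `M_λ`. -/
def weightVector (l : ℂˣ) : WeightModule ν l := (1 : ℂ[T;T⁻¹])

theorem weightVector_ne_zero (l : ℂˣ) : weightVector ν l ≠ 0 := one_ne_zero (α := ℂ[T;T⁻¹])

theorem smul_weightVector (l : ℂˣ) (r : QuantumTorus ν) :
    r • weightVector ν l = (weightRep ν l r (1 : ℂ[T;T⁻¹]) : ℂ[T;T⁻¹]) := rfl

theorem xSub_smul_weightVector (l : ℂˣ) :
    xSub ν l • weightVector ν l = 0 := by
  rw [smul_weightVector]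
  have h : weightRep ν l (xSub ν l) = laurentEval (weightX ν l) (T 1 - C (l : ℂ)) :=
    lift_coeffHom _ _ _ _ _
  have hC : laurentEval (weightX ν l) (C (l : ℂ)) = algebraMap ℂ _ (l : ℂ) :=
    AlgHom.commutes _ _
  rw [h, map_sub, laurentEval_T, zpow_one, hC, LinearMap.sub_apply]
  change (l : ℂ) • laurentScale ν⁻¹ 1 - (l : ℂ) • (1 : ℂ[T;T⁻¹]) = (0 : ℂ[T;T⁻¹])
  rw [map_one, sub_self]

theorem exists_smul_weightVector (l : ℂˣ) (v : ℂ[T;T⁻¹]) :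
    ∃ r : QuantumTorus ν, r • weightVector ν l = v := by
  induction v using LaurentPolynomial.induction_on' with
  | add p q hp hq =>
    obtain ⟨r, hr⟩ := hp
    obtain ⟨s, hs⟩ := hq
    refine ⟨r + s, ?_⟩
    rw [add_smul, hr, hs]
    rfl
  | C_mul_T n a =>
    refine ⟨monomial _ n (C a), ?_⟩
    rw [smul_weightVector]
    have h : weightRep ν l (monomial _ n (C a)) =
        laurentEval (weightX ν l) (C a) * ((weightY ^ n : (Module.End ℂ ℂ[T;T⁻¹])ˣ) : _) :=
      lift_monomial _ _ _ _ _ _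
    have hC : laurentEval (weightX ν l) (C a) = algebraMap ℂ _ a := AlgHom.commutes _ _
    rw [h, hC, weightY, ← map_zpow, Units.coe_map, laurentVar_zpow, Module.End.mul_apply]
    change a • (T n * 1 : ℂ[T;T⁻¹]) = C a * T n
    rw [mul_one, Algebra.smul_def]
    rfl

/-- The element `x - l` kills the nonzero vector `1_l`. This later excludes `α = 0`. -/
theorem xSub_not_left_invertible (q : QuantumTorus ν) (l : ℂˣ) : q * xSub ν l ≠ 1 := by
  intro h
  have := congrArg (fun r => r • weightVector ν l) h
  simp only [mul_smul, xSub_smul_weightVector, smul_zero, one_smul] at this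
  exact weightVector_ne_zero l this.symm

theorem nonempty_equiv_weightModule (hν : ∀ n : ℕ, 0 < n → ν ^ n ≠ 1)
    [IsSimpleModule (QuantumTorus ν) M] {l : ℂˣ} {m : M} (hm : m ≠ 0) (hl : xSub ν l • m = 0) :
    Nonempty (M ≃ₗ[QuantumTorus ν] WeightModule ν l) := by
  have hker : LinearMap.ker (LinearMap.toSpanSingleton (QuantumTorus ν) M m) =
      LinearMap.ker (LinearMap.toSpanSingleton (QuantumTorus ν) _ (weightVector ν l)) := by
    ext r
    rw [LinearMap.mem_ker, LinearMap.mem_ker, LinearMap.toSpanSingleton_apply,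
      LinearMap.toSpanSingleton_apply, smul_eq_zero_iff_of_xSub_smul_eq_zero hν hm hl,
      smul_eq_zero_iff_of_xSub_smul_eq_zero hν (weightVector_ne_zero l) (xSub_smul_weightVector l)]
  exact ⟨((LinearMap.quotKerEquivOfSurjective _
    (IsSimpleModule.toSpanSingleton_surjective _ hm)).symm.trans
      (Submodule.quotEquivOfEq _ _ hker)).trans
        (LinearMap.quotKerEquivOfSurjective _ (exists_smul_weightVector l))⟩

end QuantumTorus

end

/-! ### The dichotomy -/

open QuantumTorus LaurentPolynomial in
theorem theorem3p4 (ν : ℂˣ) (hν : ∀ n : ℕ, 0 < n → ν ^ n ≠ 1)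
    (M : Type*) [AddCommGroup M] [Module (QuantumTorus ν) M]
    (hM : IsSimpleModule (QuantumTorus ν) M) :
    (∃ l : ℂˣ, Nonempty (M ≃ₗ[QuantumTorus ν] WeightModule ν l)) ∨
      ∃ α : QuantumTorus ν, Irreducible (torusInclusion ν α) ∧
        Nonempty (M ≃ₗ[QuantumTorus ν] torusQuotient ν α) := by
  by_cases hfree : ∀ s : ℂ[T;T⁻¹], s ≠ 0 → ∀ n : M, ofLaurent ν s • n = 0 → n = 0
  swap
  · push Not at hfree
    obtain ⟨s, hs, m, h, hm⟩ := hfree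
    obtain ⟨l, n, hn, hl⟩ := exists_xSub_smul_eq_zero hs hm h
    exact Or.inl ⟨l, nonempty_equiv_weightModule hν hn hl⟩
  right
  have := IsSimpleModule.nontrivial (QuantumTorus ν) M
  obtain ⟨m, hm⟩ := exists_ne (0 : M)
  obtain ⟨α, hα, hJ⟩ := exists_localizedAnnihilator_eq_span (ν := ν) m
  have hmem : ∀ r : QuantumTorus ν,
      torusInclusion ν r ∈ Ideal.span {torusInclusion ν α} ↔ r • m = 0 := fun r => by
    rw [← hJ, inclusion_mem_localizedAnnihilator hfree]
  refine ⟨α, irreducible_of_isMaximal_span ?_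
    (hJ ▸ localizedAnnihilator_isMaximal hm hfree), nonempty_equiv_torusQuotient hm hmem⟩
  -- If `α = 0`, then `Ann(m) = 0`. Since `(x - 1)m ≠ 0`, simplicity gives `q(x - 1)m = m`, hence
  -- `q(x - 1) = 1`, which is impossible.
  intro h0
  have hann : ∀ r : QuantumTorus ν, r • m = 0 → r = 0 := fun r hr => by
    rw [← hmem, h0, Ideal.span_singleton_zero, Ideal.mem_bot] at hr
    exact inclusion_injective ν (hr.trans (map_zero _).symm)
  have hx : xSub ν 1 • m ≠ 0 := fun h => by
    have hne : (T 1 - C ((1 : ℂˣ) : ℂ) : ℂ[T;T⁻¹]) ≠ 0 := by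
      rw [← Polynomial.toLaurent_X, ← Polynomial.toLaurent_C, ← map_sub,
        Polynomial.toLaurent_ne_zero]
      exact Polynomial.X_sub_C_ne_zero _
    exact hm (hfree _ hne m h)
  obtain ⟨q, hq⟩ := IsSimpleModule.toSpanSingleton_surjective (QuantumTorus ν) hx m
  rw [LinearMap.toSpanSingleton_apply, ← mul_smul] at hq
  refine xSub_not_left_invertible q 1 (sub_eq_zero.mp (hann _ ?_))
  rw [sub_smul, one_smul, hq, sub_self]
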